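/- Let $n\ge 1$ and $0\le i\le\lfloor (n-1)/2\rfloor$ be integers. For $0\le k\le\lfloor n/2\rfloor$ let $\mathrm{NLP}(n,n-2k)$ be the set of lattice paths from $(0,0)$ to $(n,n-2k)$ with $n-k$ Up steps $U=(1,1)$ and $k$ Down steps $D=(1,-1)$ that stay on or above the $x$-axis. A peak of such a path is a lattice point $(x,y)$ on it at which a $U$ step ends and a $D$ step starts; $y$ is its height. For $j\ge 0$ put $D_j=\{1,\dots,j\}$, where $d\in D_j$ stands for the interval $s_d=(2d-2,2d)$ of the $x$-axis; a peak $(x,y)$ is said to lie in $D_j$ if $x\in s_d$ for some $d\in D_j$. For a standard Young tableau $T$ of shape $(n-k,k)$, an integer $m$ is a descent of $T$ if $m$ is in the first row and $m+1$ is in the second row of $T$; its height is the number of entries $\le m$ in the first row minus the number of entries $\le m$ in the second row. The descent $m$ is said to lie in $D_j$ if $m\in s_d$ for some $d\in D_j$. (a) The probability that a uniformly random path in $\mathrm{NLP}(n,n-2k)$ has all its odd-height peaks in $D_{\lfloor n/2\rfloor-i}$ is weakly decreasing in $k$ for $0\le k\le\lfloor n/2\rfloor$. (b) The probability that a uniformly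 random standard Young tableau of shape $(n-k,k)$ has all its odd-height descents in $D_{\lfloor n/2\rfloor-i}$ is weakly decreasing in $k$ for $0\le k\le\lfloor n/2\rfloor$. (c) For every $0\le k\le\lfloor n/2\rfloor$ the probabilities in (a) and (b) are equal. -/

import Mathlib

namespace TwoRowPeaks

/-- The probability that a uniformly random element of the finite nonempty set `S` satisfies `P`. -/
noncomputable def uniformProb {α : Type*} (S : Set α) (P : α → Prop) : ℚ :=
  ({a ∈ S | P a}.ncard : ℚ) / (S.ncard : ℚ)

/-- `D j = {1, 2, …, j}`. -/
def D (j : ℕ) : Finset ℕ := Finset.Icc 1 j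

/-- The abscissa `x` lies in one of the open intervals `s_d = (2d - 2, 2d)` with `d ∈ D j`. -/
def LiesIn (j x : ℕ) : Prop := ∃ d ∈ D j, 2 * d - 2 < x ∧ x < 2 * d

/-! ### Up-down paths -/

/-- The height (second coordinate) of the path with steps `w`, started at `(0, 0)`, after its first
`x` steps: the number of Up steps minus the number of Down steps among these. -/
def height (w : List DyckStep) (x : ℕ) : ℤ :=
  ((w.take x).count DyckStep.U : ℤ) - ((w.take x).count DyckStep.D : ℤ)

/-- The set of nonnegative lattice paths from `(0, 0)` to `(n, n - 2k)`: paths with `n` Up or Down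
steps, exactly `k` of them Down, that stay on or above the `x`-axis. -/
def NLP (n k : ℕ) : Set (List DyckStep) :=
  {w | w.length = n ∧ w.count DyckStep.D = k ∧ ∀ x, 0 ≤ height w x}

/-- The path `w` has a peak at its lattice point with abscissa `x`: an Up step ends there and
a Down step starts there. (Entry `x` of the list is the step from abscissa `x` to `x + 1`.) -/
def IsPeak (w : List DyckStep) (x : ℕ) : Prop :=
  0 < x ∧ w[x - 1]? = some DyckStep.U ∧ w[x]? = some DyckStep.D

/-- All peaks of `w` at odd height lie in `D j`. -/
def OddPeaksIn (j : ℕ) (w : List DyckStep) : Prop :=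
  ∀ x, IsPeak w x → Odd (height w x) → LiesIn j x

/-- The probability that a uniformly random nonnegative path with `n` steps, `k` of them Down, has
all its odd-height peaks in `D j`. -/
noncomputable def pathProb (n k j : ℕ) : ℚ := uniformProb (NLP n k) (OddPeaksIn j)

/-! ### Standard Young tableaux -/

/-- A standard Young tableau of shape `μ`: a filling of the cells of `μ`, increasing along rows and
columns, in which each of `1, …, |μ|` occurs exactly once. (As the entries are distinct, weak
increase along rows is strict increase.) -/
structure StandardYoungTableau (μ : YoungDiagram) extends SemistandardYoungTableau μ where
  bijOn' : Set.BijOn (fun c : ℕ × ℕ => entry c.1 c.2) (μ.cells : Set (ℕ × ℕ)) (Set.Icc 1 μ.card)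

/-- The two-row shape `(n - k, k)`; the second row is empty if `k = 0`. -/
def twoRow (n k : ℕ) (hk : k ≤ n / 2) : YoungDiagram :=
  YoungDiagram.ofRowLens [n - k, k] (by
    have h : k ≤ n - k := by omega
    simpa [List.SortedGE, antitone_iff_forall_lt, Fin.forall_fin_two] using h)

namespace StandardYoungTableau

variable {μ : YoungDiagram}

/-- `m` appears in row `r` of `T` (rows are numbered from `0`). -/
def InRow (T : StandardYoungTableau μ) (r m : ℕ) : Prop :=
  ∃ c, (r, c) ∈ μ ∧ T.entry r c = m

/-- For a tableau with at most two rows: `m` is a descent of `T` if `m` is in the first row and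
`m + 1` is in the second row. -/
def IsDescent (T : StandardYoungTableau μ) (m : ℕ) : Prop :=
  T.InRow 0 m ∧ T.InRow 1 (m + 1)

/-- The number of entries of row `r` in the restriction of `T` to the entries `1, …, m`. -/
def rowCount (T : StandardYoungTableau μ) (r m : ℕ) : ℕ :=
  ({c ∈ μ.cells | c.1 = r ∧ T.entry c.1 c.2 ≤ m} : Finset (ℕ × ℕ)).card

/-- The number of entries in the first row minus the number of entries in the second row of the
restriction of `T` to the entries `1, …, m`. -/
def rowDiff (T : StandardYoungTableau μ) (m : ℕ) : ℤ :=
  (T.rowCount 0 m : ℤ) - (T.rowCount 1 m : ℤ)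

/-- All descents of `T` with odd height lie in `D j`. -/
def OddDescentsIn (j : ℕ) (T : StandardYoungTableau μ) : Prop :=
  ∀ m, T.IsDescent m → Odd (T.rowDiff m) → LiesIn j m

/-- There are finitely many standard Young tableaux of a given shape. -/
instance : Finite (StandardYoungTableau μ) := by
  let f : StandardYoungTableau μ → (μ.cells → Set.Icc 1 μ.card) :=
    fun T c => ⟨T.entry c.1.1 c.1.2, T.bijOn'.mapsTo c.2⟩
  apply Finite.of_injective f
  rintro ⟨S, hS⟩ ⟨T, hT⟩ h
  have : S = T := by
    ext r c
    by_cases hc : (r, c) ∈ μ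
    · exact congrArg Subtype.val (congrFun h ⟨(r, c), hc⟩)
    · rw [S.zeros hc, T.zeros hc]
  subst this
  rfl

end StandardYoungTableau

/-- There are finitely many paths with `n` steps. -/
theorem finite_NLP (n k : ℕ) : (NLP n k).Finite := by
  have : Finite DyckStep := Finite.of_injective (fun s => decide (s = DyckStep.U)) (by
    intro a b; cases a <;> cases b <;> simp)
  exact (List.finite_length_eq DyckStep n).subset fun w hw => hw.1

/-- The probability that a uniformly random standard Young tableau of shape `(n - k, k)` has all its
odd-height descents in `D j`. -/
noncomputable def sytProb (n k : ℕ) (hk : k ≤ n / 2) (j : ℕ) : ℚ :=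
  uniformProb (Set.univ : Set (StandardYoungTableau (twoRow n k hk)))
    (StandardYoungTableau.OddDescentsIn j)

end TwoRowPeaks

namespace TwoRowPeaks

/-! ### Step operators on functions of the height -/

/-! The height of a path at abscissa `x` has the parity of `x`, so odd-height peaks are those at odd
`x`, and an odd `x` lies in `D j` exactly when `x < 2 * j`. For `j = n / 2 - i` the condition
therefore reads: the first `2 * j` steps are free, none of the next `i` pairs of steps is UD, and
for odd `n` one more free step follows.

Write S for `stepOp`, P for `pairOp` and e_h for the indicator of height h. A pair UD is always
allowed and returns to its starting height, so S² = P + 1; in particular P commutes with S. Hence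
the good paths are counted, by final height, by S^(n-2i) P^i e_0 (`pathCount_eq`), and all paths by
S^n e_0 (`ncard_NLP`). Part (a) says that the quotient of these vectors increases with the final
height n - 2k.

S preserves monotonicity of quotients; P preserves it on odd heights (on even heights the boundary
spoils this). As n - 2i ≥ 1, one factor S can be spent on S e_0 = e_1, which moves the problem to
odd heights. There S^(2i) e_1 = (P + 1)^i e_1 is a nonnegative combination of the P^c e_1 with c ≤
i, and P^i e_1 / P^c e_1 is monotone because it arises by applying P^c to P^(i-c) e_1 / e_1, whose
denominator lives at the lowest odd height (`quotientMono_pairOp_pow`). Applying the remaining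
S^(n-1-2i) gives (a).

Part (c) is the classical bijection sending a tableau to the path whose `m`-th step is Up iff `m` is
in the first row; it carries descents to peaks and preserves heights. Part (b) follows from (a) and
(c). -/

/-- One Up or Down step that stays on or above the axis, acting on the numbers of paths ending at
each height. -/
def stepOp : Module.End ℕ (ℕ → ℕ) where
  toFun f h := match h with
    | 0 => f 1
    | h + 1 => f h + f (h + 2)
  map_add' f g := by
    funext h
    cases h <;> (simp only [Pi.add_apply]; try ring)
  map_smul' c f := by
    funext h
    cases h <;> (simp only [Pi.smul_apply, smul_eq_mul, RingHom.id_apply]; try ring)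

/-- Two steps that stay on or above the axis and are not an Up step followed by a Down step. -/
def pairOp : Module.End ℕ (ℕ → ℕ) where
  toFun f h := match h with
    | 0 => f 2
    | 1 => f 1 + f 3
    | h + 2 => f h + f (h + 2) + f (h + 4)
  map_add' f g := by
    funext h
    rcases h with _ | _ | h <;> (simp only [Pi.add_apply]; try ring)
  map_smul' c f := by
    funext h
    rcases h with _ | _ | h <;> (simp only [Pi.smul_apply, smul_eq_mul, RingHom.id_apply]; try ring)

theorem stepOp_zero (f : ℕ → ℕ) : stepOp f 0 = f 1 := rfl

theorem stepOp_succ (f : ℕ → ℕ) (h : ℕ) : stepOp f (h + 1) = f h + f (h + 2) := rfl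

theorem pairOp_zero (f : ℕ → ℕ) : pairOp f 0 = f 2 := rfl

theorem pairOp_one (f : ℕ → ℕ) : pairOp f 1 = f 1 + f 3 := rfl

theorem pairOp_add_two (f : ℕ → ℕ) (h : ℕ) :
    pairOp f (h + 2) = f h + f (h + 2) + f (h + 4) := rfl

theorem stepOp_stepOp (f : ℕ → ℕ) : stepOp (stepOp f) = pairOp f + f := by
  funext h
  rcases h with _ | _ | h
  · simp only [Pi.add_apply, stepOp_zero, pairOp_zero, stepOp_succ]; ring
  · simp only [Pi.add_apply, zero_add, stepOp_zero, pairOp_one, stepOp_succ]; ring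
  · simp only [Pi.add_apply, pairOp_add_two, stepOp_succ]; ring

theorem stepOp_sq : stepOp ^ 2 = pairOp + 1 := by
  ext1 f
  rw [pow_two]
  exact stepOp_stepOp f

/-- `pairOp` is `stepOp ^ 2` minus the identity; over ℕ the subtraction becomes a cancellation. -/
theorem commute_pairOp_stepOp : Commute pairOp stepOp := by
  have h : (pairOp + 1) * stepOp = stepOp * (pairOp + 1) := by
    rw [← stepOp_sq, ← pow_succ, ← pow_succ']
  rw [add_mul, mul_add, one_mul, mul_one] at h
  refine LinearMap.ext fun f => ?_
  have := LinearMap.congr_fun h f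
  exact add_right_cancel this

/-! ### Monotone quotients, in cross-multiplied form so that zero denominators are allowed -/

/-- On arguments of parity `p`, the quotient `x / y` is weakly increasing. -/
def QuotientMono (p : ℕ) (x y : ℕ → ℕ) : Prop :=
  ∀ s t, s ≤ t → s % 2 = p → t % 2 = p → x s * y t ≤ x t * y s

theorem QuotientMono.add_right {p : ℕ} {x y z : ℕ → ℕ} (hy : QuotientMono p x y)
    (hz : QuotientMono p x z) : QuotientMono p x (y + z) := by
  intro s t hst hs ht
  simp only [Pi.add_apply, mul_add]
  exact add_le_add (hy s t hst hs ht) (hz s t hst hs ht)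

/-- For `s < t` of equal parity, every neighbour of `s` is at most every neighbour of `t`, so the
expanded products compare term by term. -/
theorem QuotientMono.stepOp {p : ℕ} (hp : p < 2) {x y : ℕ → ℕ} (h : QuotientMono p x y) :
    QuotientMono ((p + 1) % 2) (stepOp x) (stepOp y) := by
  intro s t hst hs ht
  rcases eq_or_lt_of_le hst with rfl | hlt
  · exact le_rfl
  obtain ⟨t, rfl⟩ : ∃ t', t = t' + 1 := ⟨t - 1, by omega⟩
  rcases s with _ | s
  · simp only [stepOp_zero, stepOp_succ, mul_add, add_mul]
    exact add_le_add (h 1 t (by omega) (by omega) (by omega))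
      (h 1 (t + 2) (by omega) (by omega) (by omega))
  · simp only [stepOp_succ]
    have h1 := h s t (by omega) (by omega) (by omega)
    have h2 := h s (t + 2) (by omega) (by omega) (by omega)
    have h3 := h (s + 2) t (by omega) (by omega) (by omega)
    have h4 := h (s + 2) (t + 2) (by omega) (by omega) (by omega)
    linarith

/-- Parity 1 is essential: at height 0 the term `f 0` is missing from `pairOp f 0`, and the
comparison of heights 0 and 2 would require `x 2 * y 0 ≤ x 0 * y 2`. -/
theorem QuotientMono.pairOp {x y : ℕ → ℕ} (h : QuotientMono 1 x y) :
    QuotientMono 1 (pairOp x) (pairOp y) := by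
  intro s t hst hs ht
  rcases eq_or_lt_of_le hst with rfl | hlt
  · exact le_rfl
  obtain ⟨t, rfl⟩ : ∃ t', t = t' + 2 := ⟨t - 2, by omega⟩
  rcases s with _ | _ | s
  · omega
  · have h1 := h 1 t (by omega) (by omega) (by omega)
    have h2 := h 1 (t + 2) (by omega) (by omega) (by omega)
    have h3 := h 1 (t + 4) (by omega) (by omega) (by omega)
    have h5 := h 3 (t + 2) (by omega) (by omega) (by omega)
    have h6 := h 3 (t + 4) (by omega) (by omega) (by omega)
    simp only [zero_add, pairOp_one, pairOp_add_two]
    rcases eq_or_ne t 1 with rfl | hne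
    · linarith
    · have h4 := h 3 t (by omega) (by omega) (by omega)
      linarith
  · have h1 := h s t (by omega) (by omega) (by omega)
    have h2 := h s (t + 2) (by omega) (by omega) (by omega)
    have h3 := h s (t + 4) (by omega) (by omega) (by omega)
    have h4 := h (s + 2) t (by omega) (by omega) (by omega)
    have h5 := h (s + 2) (t + 2) (by omega) (by omega) (by omega)
    have h6 := h (s + 2) (t + 4) (by omega) (by omega) (by omega)
    have h8 := h (s + 4) (t + 2) (by omega) (by omega) (by omega)
    have h9 := h (s + 4) (t + 4) (by omega) (by omega) (by omega)
    simp only [pairOp_add_two]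
    -- For adjacent heights the pair (`s + 4`, `t`) is in the wrong order, but its product and that
    -- of (`s + 2`, `t + 2`) occur on both sides and cancel.
    rcases eq_or_ne t (s + 2) with rfl | hne
    · linarith
    · have h7 := h (s + 4) t (by omega) (by omega) (by omega)
      linarith

theorem QuotientMono.pairOp_pow {x y : ℕ → ℕ} (h : QuotientMono 1 x y) (a : ℕ) :
    QuotientMono 1 ((TwoRowPeaks.pairOp ^ a) x) ((TwoRowPeaks.pairOp ^ a) y) := by
  induction a with
  | zero => exact h
  | succ a ih =>
    rw [pow_succ']
    exact ih.pairOp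

theorem QuotientMono.stepOp_pow {p : ℕ} (hp : p < 2) {x y : ℕ → ℕ} (h : QuotientMono p x y)
    (a : ℕ) : QuotientMono ((p + a) % 2) ((TwoRowPeaks.stepOp ^ a) x)
      ((TwoRowPeaks.stepOp ^ a) y) := by
  induction a with
  | zero => rwa [add_zero, Nat.mod_eq_of_lt hp]
  | succ a ih =>
    rw [pow_succ', show (p + (a + 1)) % 2 = ((p + a) % 2 + 1) % 2 by omega]
    exact ih.stepOp (Nat.mod_lt _ two_pos)

theorem stepOp_single_zero : stepOp (Pi.single 0 1) = Pi.single 1 1 := by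
  funext h
  rcases h with _ | _ | h <;> simp [stepOp_zero, stepOp_succ]

theorem quotientMono_single (x : ℕ → ℕ) : QuotientMono 1 x (Pi.single 1 1) := by
  intro s t hst hs ht
  rcases eq_or_ne t 1 with rfl | hne
  · obtain rfl : s = 1 := by omega
    exact le_rfl
  · simp [Pi.single_apply, hne]

/-- Each `stepOp ^ 2` in the denominator splits as `pairOp + 1`, raising `b` by one or leaving it;
the bound `b + q ≤ a` keeps every resulting exponent at most `a`. The general `b` is what makes this
induction close. -/
theorem quotientMono_pairOp_pow (q a b : ℕ) (h : b + q ≤ a) :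
    QuotientMono 1 ((pairOp ^ a) (Pi.single 1 1))
      ((stepOp ^ (2 * q)) ((pairOp ^ b) (Pi.single 1 1))) := by
  induction q generalizing b with
  | zero =>
    obtain ⟨c, rfl⟩ := Nat.exists_eq_add_of_le h
    rw [add_zero, pow_add]
    exact (quotientMono_single _).pairOp_pow b
  | succ q ih =>
    have h1 := ih (b + 1) (by omega)
    have h2 := ih b (by omega)
    rw [show 2 * (q + 1) = 2 * q + 2 by ring, pow_add, stepOp_sq]
    have := h1.add_right h2
    rw [← map_add, pow_succ'] at this
    exact this

/-- Replacing `i` of the pairs of steps by restricted pairs yields an increasing quotient. -/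
theorem quotientMono_pairOp_pow_stepOp_pow (i r : ℕ) :
    QuotientMono ((r + 1) % 2) ((stepOp ^ (r + 1)) ((pairOp ^ i) (Pi.single 0 1)))
      ((stepOp ^ (r + 1 + 2 * i)) (Pi.single 0 1)) := by
  -- One `stepOp` is held back to turn height 0 into height 1; only `r` of the `r + 1` are applied
  -- here.
  have h := (quotientMono_pairOp_pow i i 0 (by omega)).stepOp_pow (by norm_num) r
  rw [← stepOp_single_zero, add_comm 1 r] at h
  convert h using 1
  · rw [pow_succ]
    change (stepOp ^ r) ((stepOp * pairOp ^ i) _) = (stepOp ^ r) ((pairOp ^ i * stepOp) _)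
    rw [(commute_pairOp_stepOp.pow_left i).eq]
  · rw [show r + 1 + 2 * i = r + 2 * i + 1 by ring, pow_succ, pow_add]
    rfl

/-! ### Counting paths -/

theorem height_append_of_le {v : List DyckStep} (u : List DyckStep) {x : ℕ} (hx : x ≤ v.length) :
    height (v ++ u) x = height v x := by
  rw [height, height, List.take_append_of_le_length hx]

theorem height_of_length_le {v : List DyckStep} {x : ℕ} (hx : v.length ≤ x) :
    height v x = height v v.length := by
  rw [height, height, List.take_of_length_le hx, List.take_length]

theorem height_concat_U (v : List DyckStep) :
    height (v ++ [DyckStep.U]) (v.length + 1) = height v v.length + 1 := by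
  rw [height, height, List.take_of_length_le (by simp), List.take_length]
  simp [List.count_append]
  ring

theorem height_concat_D (v : List DyckStep) :
    height (v ++ [DyckStep.D]) (v.length + 1) = height v v.length - 1 := by
  rw [height, height, List.take_of_length_le (by simp), List.take_length]
  simp [List.count_append]
  ring

theorem height_nonneg_concat_iff (v : List DyckStep) (s : DyckStep) :
    (∀ x, 0 ≤ height (v ++ [s]) x) ↔
      (∀ x, 0 ≤ height v x) ∧ 0 ≤ height (v ++ [s]) (v.length + 1) := by
  constructor
  · intro h
    refine ⟨fun x => ?_, h _⟩
    rcases le_total x v.length with hx | hx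
    · rw [← height_append_of_le [s] hx]
      exact h x
    · rw [height_of_length_le hx, ← height_append_of_le [s] le_rfl]
      exact h _
  · rintro ⟨h, h'⟩ x
    rcases Nat.lt_or_ge v.length x with hx | hx
    · rw [height_of_length_le (by simpa using hx)]
      simpa using h'
    · rw [height_append_of_le [s] hx]
      exact h x

theorem count_U_add_count_D (w : List DyckStep) :
    w.count DyckStep.U + w.count DyckStep.D = w.length := by
  induction w with
  | nil => rfl
  | cons s w ih => cases s <;> simp <;> omega

/-- The numbers of Up and Down steps among the first `x` add up to `x`. The bound matters, since
`height` is constant beyond the end of the path. -/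
theorem odd_height_iff {w : List DyckStep} {x : ℕ} (hx : x ≤ w.length) :
    Odd (height w x) ↔ Odd x := by
  have h := count_U_add_count_D (w.take x)
  rw [List.length_take, min_eq_left hx] at h
  rw [height, Int.odd_iff, Nat.odd_iff]
  omega

theorem IsPeak.lt_length {w : List DyckStep} {x : ℕ} (h : IsPeak w x) : x < w.length :=
  (List.getElem?_eq_some_iff.mp h.2.2).1

theorem isPeak_concat_iff (v : List DyckStep) (s : DyckStep) (x : ℕ) :
    IsPeak (v ++ [s]) x ↔ IsPeak v x ∨
      (x = v.length ∧ 0 < x ∧ v[x - 1]? = some DyckStep.U ∧ s = DyckStep.D) := by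
  rcases lt_trichotomy x v.length with hx | rfl | hx
  · rw [IsPeak, IsPeak, List.getElem?_append_left hx,
      List.getElem?_append_left (by omega : x - 1 < v.length)]
    constructor
    · exact Or.inl
    · rintro (h | h)
      · exact h
      · omega
  · constructor
    · rintro ⟨h0, h1, h2⟩
      rw [List.getElem?_append_left (by omega)] at h1
      exact Or.inr ⟨rfl, h0, h1, by simpa using h2⟩
    · rintro (h | ⟨-, h0, h1, rfl⟩)
      · exact absurd h.lt_length (lt_irrefl _)
      · exact ⟨h0, by rwa [List.getElem?_append_left (by omega)], by simp⟩
  · constructor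
    · intro h
      have := h.lt_length
      simp at this
      omega
    · rintro (h | h)
      · exact absurd h.lt_length (by omega)
      · omega

theorem liesIn_iff_of_odd {j x : ℕ} (hx : Odd x) : LiesIn j x ↔ x < 2 * j := by
  obtain ⟨y, rfl⟩ := hx
  simp only [LiesIn, D, Finset.mem_Icc]
  constructor
  · rintro ⟨d, ⟨h1, h2⟩, h3, h4⟩
    omega
  · intro h
    exact ⟨y + 1, ⟨by omega, by omega⟩, by omega, by omega⟩

theorem oddPeaksIn_iff (j : ℕ) (w : List DyckStep) :
    OddPeaksIn j w ↔ ∀ x, IsPeak w x → Odd x → x < 2 * j := by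
  refine forall_congr' fun x => forall_congr' fun hp => ?_
  rw [odd_height_iff hp.lt_length.le]
  exact forall_congr' fun hx => liesIn_iff_of_odd hx

theorem oddPeaksIn_concat_iff (j : ℕ) (v : List DyckStep) (s : DyckStep) :
    OddPeaksIn j (v ++ [s]) ↔ OddPeaksIn j v ∧
      (Odd v.length → v[v.length - 1]? = some DyckStep.U → s = DyckStep.D → v.length < 2 * j) := by
  simp only [oddPeaksIn_iff, isPeak_concat_iff]
  constructor
  · intro h
    exact ⟨fun x hx => h x (Or.inl hx), fun ho hU hD => h _ (Or.inr ⟨rfl, ho.pos, hU, hD⟩) ho⟩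
  · rintro ⟨h, h'⟩ x (hx | ⟨rfl, -, hU, hD⟩) ho
    · exact h x hx ho
    · exact h' ho hU hD

/-- Nonnegative paths with `n` steps and final height `h` all of whose odd-height peaks lie in
`D j`. -/
def pathsTo (j n : ℕ) (h : ℤ) : Set (List DyckStep) :=
  {w | w.length = n ∧ (∀ x, 0 ≤ height w x) ∧ height w n = h ∧ OddPeaksIn j w}

/-- The extensions by one step of the paths in `pathsTo j n`, with final height `h`. -/
def extensionsTo (j n : ℕ) (h : ℤ) : Set (List DyckStep) :=
  (fun v => v ++ [DyckStep.U]) '' pathsTo j n (h - 1) ∪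
    (fun v => v ++ [DyckStep.D]) '' pathsTo j n (h + 1)

/-- The numbers of paths in `pathsTo j n`, as a function of the final height. -/
noncomputable def pathCount (j n : ℕ) : ℕ → ℕ := fun h => (pathsTo j n h).ncard

instance : Finite DyckStep :=
  Finite.of_injective (fun s => decide (s = DyckStep.U)) (by
    intro a b; cases a <;> cases b <;> simp)

theorem finite_pathsTo (j n : ℕ) (h : ℤ) : (pathsTo j n h).Finite :=
  (List.finite_length_eq DyckStep n).subset fun _ hw => hw.1

theorem concat_injective (u : List DyckStep) : Function.Injective (fun v => v ++ u) :=
  fun _ _ h => List.append_cancel_right h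

theorem pathsTo_of_neg {j n : ℕ} {h : ℤ} (hh : h < 0) : pathsTo j n h = ∅ := by
  refine Set.eq_empty_of_forall_notMem ?_
  rintro w ⟨-, h1, h2, -⟩
  have := h1 n
  omega

theorem mem_extensionsTo_iff (j n h : ℕ) (w : List DyckStep) :
    w ∈ extensionsTo j n h ↔ ∃ v s, w = v ++ [s] ∧ v.length = n ∧ (∀ x, 0 ≤ height w x) ∧
      height w (n + 1) = h ∧ OddPeaksIn j v := by
  constructor
  · rintro (⟨v, ⟨rfl, h1, h2, h3⟩, rfl⟩ | ⟨v, ⟨rfl, h1, h2, h3⟩, rfl⟩)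
    · have : height (v ++ [DyckStep.U]) (v.length + 1) = h := by rw [height_concat_U]; omega
      exact ⟨v, _, rfl, rfl, (height_nonneg_concat_iff _ _).2 ⟨h1, by omega⟩, this, h3⟩
    · have : height (v ++ [DyckStep.D]) (v.length + 1) = h := by rw [height_concat_D]; omega
      exact ⟨v, _, rfl, rfl, (height_nonneg_concat_iff _ _).2 ⟨h1, by omega⟩, this, h3⟩
  · rintro ⟨v, s, rfl, rfl, h1, h2, h3⟩
    have h4 := ((height_nonneg_concat_iff _ _).1 h1).1
    cases s
    · rw [height_concat_U] at h2
      exact Or.inl ⟨v, ⟨rfl, h4, by omega, h3⟩, rfl⟩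
    · rw [height_concat_D] at h2
      exact Or.inr ⟨v, ⟨rfl, h4, by omega, h3⟩, rfl⟩

theorem ncard_extensionsTo (j n h : ℕ) :
    (extensionsTo j n h).ncard = stepOp (pathCount j n) h := by
  rw [extensionsTo, Set.ncard_union_eq ?_ ((finite_pathsTo _ _ _).image _)
    ((finite_pathsTo _ _ _).image _), Set.ncard_image_of_injective _ (concat_injective _),
    Set.ncard_image_of_injective _ (concat_injective _)]
  · rcases h with _ | h
    · rw [pathsTo_of_neg (by norm_num), Set.ncard_empty, zero_add]
      rfl
    · rw [stepOp_succ, pathCount]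
      push_cast
      rw [add_sub_cancel_right, add_assoc, one_add_one_eq_two]
      rfl
  · rw [Set.disjoint_left]
    rintro _ ⟨v, -, rfl⟩ ⟨u, -, h⟩
    simpa using List.append_inj_right' h rfl

theorem pathCount_zero (j : ℕ) : pathCount j 0 = Pi.single 0 1 := by
  funext h
  rw [pathCount, Pi.single_apply]
  split_ifs with hh
  · subst hh
    rw [Set.ncard_eq_one]
    refine ⟨[], Set.eq_singleton_iff_unique_mem.2 ⟨⟨rfl, by simp [height], by simp [height], ?_⟩,
      fun w hw => List.length_eq_zero_iff.1 hw.1⟩⟩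
    exact fun x hx => absurd hx.lt_length (by simp)
  · rw [Set.ncard_eq_zero (finite_pathsTo _ _ _)]
    refine Set.eq_empty_of_forall_notMem ?_
    rintro w ⟨-, -, h2, -⟩
    simp [height] at h2
    omega

theorem exists_eq_concat_of_length_eq_succ {n : ℕ} {w : List DyckStep} (h : w.length = n + 1) :
    ∃ v s, w = v ++ [s] := by
  rcases List.eq_nil_or_concat w with rfl | ⟨v, s, rfl⟩
  · simp at h
  · exact ⟨v, s, by simp⟩

/-- The only peak that the last step can create is at abscissa `n`, where `hn` makes it harmless. -/
theorem pathsTo_succ {j n : ℕ} (hn : Even n ∨ n < 2 * j) (h : ℕ) :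
    pathsTo j (n + 1) h = extensionsTo j n h := by
  ext w
  rw [mem_extensionsTo_iff]
  constructor
  · rintro ⟨h0, h1, h2, h3⟩
    obtain ⟨v, s, rfl⟩ := exists_eq_concat_of_length_eq_succ h0
    exact ⟨v, s, rfl, by simpa using h0, h1, h2, ((oddPeaksIn_concat_iff _ _ _).1 h3).1⟩
  · rintro ⟨v, s, rfl, rfl, h1, h2, h3⟩
    refine ⟨by simp, h1, h2, (oddPeaksIn_concat_iff _ _ _).2 ⟨h3, fun ho _ _ => ?_⟩⟩
    exact hn.resolve_left (Nat.not_even_iff_odd.2 ho)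

theorem pathCount_succ {j n : ℕ} (hn : Even n ∨ n < 2 * j) :
    pathCount j (n + 1) = stepOp (pathCount j n) := by
  funext h
  rw [← ncard_extensionsTo, pathCount, pathsTo_succ hn]

/-- An extension is bad only through a new peak at the odd abscissa `n + 1 > 2 * j`, so it ends in
UD; conversely UD may be appended to any good path of length `n`. -/
theorem extensionsTo_succ {j n : ℕ} (hn : Even n) (hj : 2 * j ≤ n) (h : ℕ) :
    extensionsTo j (n + 1) h = pathsTo j (n + 2) h ∪
      (fun v => v ++ [DyckStep.U, DyckStep.D]) '' pathsTo j n h := by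
  have hconcat (u : List DyckStep) :
      u ++ [DyckStep.U, DyckStep.D] = (u ++ [DyckStep.U]) ++ [DyckStep.D] := by simp
  have hheight (u : List DyckStep) :
      height (u ++ [DyckStep.U, DyckStep.D]) (u.length + 2) = height u u.length := by
    have h1 := height_concat_D (u ++ [DyckStep.U])
    rw [List.length_append, List.length_singleton, height_concat_U] at h1
    rw [hconcat, h1, add_sub_cancel_right]
  ext w
  rw [mem_extensionsTo_iff]
  constructor
  · rintro ⟨v, s, rfl, h0, h1, h2, h3⟩
    by_cases h4 : OddPeaksIn j (v ++ [s])
    · exact Or.inl ⟨by simp [h0], h1, h2, h4⟩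
    · right
      rw [oddPeaksIn_concat_iff] at h4
      push Not at h4
      obtain ⟨-, hU, rfl, -⟩ := h4 h3
      obtain ⟨u, t, rfl⟩ := exists_eq_concat_of_length_eq_succ h0
      obtain rfl : t = DyckStep.U := by simpa using hU
      obtain rfl : u.length = n := by simpa using h0
      rw [← hconcat] at h1 h2 ⊢
      refine ⟨u, ⟨rfl, fun x => ?_, by rw [← h2, hheight], ((oddPeaksIn_concat_iff _ _ _).1 h3).1⟩,
        rfl⟩
      rw [hconcat] at h1
      exact ((height_nonneg_concat_iff _ _).1 ((height_nonneg_concat_iff _ _).1 h1).1).1 x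
  · rintro (⟨h0, h1, h2, h3⟩ | ⟨u, ⟨rfl, h1, h2, h3⟩, rfl⟩)
    · obtain ⟨v, s, rfl⟩ := exists_eq_concat_of_length_eq_succ h0
      exact ⟨v, s, rfl, by simpa using h0, h1, h2, ((oddPeaksIn_concat_iff _ _ _).1 h3).1⟩
    · have h4 : height (u ++ [DyckStep.U, DyckStep.D]) (u.length + 2) = h := by rw [hheight, h2]
      refine ⟨u ++ [DyckStep.U], DyckStep.D, hconcat u, by simp, ?_, h4,
        (oddPeaksIn_concat_iff _ _ _).2 ⟨h3, fun ho => absurd hn (Nat.not_even_iff_odd.2 ho)⟩⟩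
      have h5 : 0 ≤ height (u ++ [DyckStep.U]) (u.length + 1) := by
        rw [height_concat_U]
        have := h1 u.length
        omega
      simp only [hconcat] at h4 ⊢
      refine (height_nonneg_concat_iff _ _).2 ⟨(height_nonneg_concat_iff _ _).2 ⟨h1, h5⟩, ?_⟩
      rw [List.length_append, List.length_singleton, h4]
      omega

/-- Two free steps count the good paths of length `n + 2` plus one bad path for each good path of
length `n`. By `stepOp_stepOp` they also give `pairOp` plus the identity; the extra terms cancel. -/
theorem pathCount_add_two {j n : ℕ} (hn : Even n) (hj : 2 * j ≤ n) :
    pathCount j (n + 2) = pairOp (pathCount j n) := by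
  have key : stepOp (stepOp (pathCount j n)) = pathCount j (n + 2) + pathCount j n := by
    rw [← pathCount_succ (Or.inl hn)]
    funext h
    rw [← ncard_extensionsTo, extensionsTo_succ hn hj, Set.ncard_union_eq ?_
      (finite_pathsTo _ _ _) ((finite_pathsTo _ _ _).image _),
      Set.ncard_image_of_injective _ (concat_injective _)]
    · rfl
    · rw [Set.disjoint_left]
      rintro _ ⟨-, -, -, h3⟩ ⟨v, ⟨rfl, -⟩, rfl⟩
      rw [oddPeaksIn_iff] at h3
      have := h3 (v.length + 1) ⟨by omega, by simp, by simp; rfl⟩ hn.add_one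
      omega
  rw [stepOp_stepOp] at key
  exact (add_right_cancel key).symm

theorem pathCount_eq_stepOp_pow {j n : ℕ} (hn : n ≤ 2 * j + 1) :
    pathCount j n = (stepOp ^ n) (Pi.single 0 1) := by
  induction n with
  | zero => exact pathCount_zero j
  | succ n ih =>
    rw [pathCount_succ, ih (by omega), pow_succ']
    · rfl
    -- The boundary case is `n = 2 * j`, which is even and so creates no odd-height peak.
    · rcases Nat.lt_or_ge n (2 * j) with h | h
      · exact Or.inr h
      · exact Or.inl ⟨j, by omega⟩

theorem pathCount_two_mul_add (j i : ℕ) :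
    pathCount j (2 * j + 2 * i) = (stepOp ^ (2 * j)) ((pairOp ^ i) (Pi.single 0 1)) := by
  induction i with
  | zero => exact pathCount_eq_stepOp_pow (by omega)
  | succ i ih =>
    rw [show 2 * j + 2 * (i + 1) = 2 * j + 2 * i + 2 by ring,
      pathCount_add_two ⟨j + i, by ring⟩ (by omega), ih, pow_succ']
    exact LinearMap.congr_fun (commute_pairOp_stepOp.pow_right (2 * j)).eq _

theorem pathCount_eq {n i : ℕ} (hn : 0 < n) (hi : i ≤ (n - 1) / 2) :
    pathCount (n / 2 - i) n = (stepOp ^ (n - 2 * i)) ((pairOp ^ i) (Pi.single 0 1)) := by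
  obtain ⟨j, hj⟩ : ∃ j, j = n / 2 - i := ⟨_, rfl⟩
  rw [← hj]
  rcases Nat.even_or_odd' n with ⟨m, rfl | rfl⟩
  · rw [show 2 * m = 2 * j + 2 * i by omega, pathCount_two_mul_add]
    congr 2
    omega
  · rw [show 2 * m + 1 = 2 * j + 2 * i + 1 by omega, pathCount_succ (Or.inl ⟨j + i, by ring⟩),
      pathCount_two_mul_add, show 2 * j + 2 * i + 1 - 2 * i = 2 * j + 1 by omega, pow_succ']
    rfl

/-! ### Monotonicity of the probabilities for paths -/

theorem setOf_mem_NLP_oddPeaksIn {n k : ℕ} (hk : k ≤ n / 2) (j : ℕ) :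
    {w ∈ NLP n k | OddPeaksIn j w} = pathsTo j n ((n - 2 * k : ℕ) : ℤ) := by
  ext w
  simp only [NLP, pathsTo, Set.mem_ofPred_eq]
  constructor
  · rintro ⟨⟨h0, h1, h2⟩, h3⟩
    refine ⟨h0, h2, ?_, h3⟩
    have := count_U_add_count_D w
    rw [height, List.take_of_length_le h0.le]
    omega
  · rintro ⟨h0, h1, h2, h3⟩
    have := count_U_add_count_D w
    rw [height, List.take_of_length_le h0.le] at h2
    exact ⟨⟨h0, by omega, h1⟩, h3⟩

/-- With `j = n / 2` the restriction is void, so the total number of paths is also a `pathCount`. -/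
theorem oddPeaksIn_half {n k : ℕ} {w : List DyckStep} (hw : w ∈ NLP n k) :
    OddPeaksIn (n / 2) w := by
  rw [oddPeaksIn_iff]
  intro x hx ho
  have := hx.lt_length
  rw [hw.1] at this
  rw [Nat.odd_iff] at ho
  omega

theorem ncard_NLP {n k : ℕ} (hk : k ≤ n / 2) :
    (NLP n k).ncard = (stepOp ^ n) (Pi.single 0 1) (n - 2 * k) := by
  rw [← pathCount_eq_stepOp_pow (by omega : n ≤ 2 * (n / 2) + 1), pathCount,
    ← setOf_mem_NLP_oddPeaksIn hk]
  congr 1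
  ext w
  exact ⟨fun h => ⟨h, oddPeaksIn_half h⟩, fun h => h.1⟩

theorem NLP_nonempty {n k : ℕ} (hk : k ≤ n / 2) : (NLP n k).Nonempty := by
  refine ⟨List.replicate (n - k) DyckStep.U ++ List.replicate k DyckStep.D, ?_, ?_, fun x => ?_⟩
  · simp; omega
  · simp [List.count_append, List.count_replicate]
  · simp [height, List.take_append, List.count_append, List.count_replicate]
    omega

theorem pathProb_eq {n k i : ℕ} (hn : 0 < n) (hi : i ≤ (n - 1) / 2) (hk : k ≤ n / 2) :
    pathProb n k (n / 2 - i) =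
      ((stepOp ^ (n - 2 * i)) ((pairOp ^ i) (Pi.single 0 1)) (n - 2 * k) : ℕ) /
        ((stepOp ^ n) (Pi.single 0 1) (n - 2 * k) : ℕ) := by
  rw [pathProb, uniformProb, ncard_NLP hk, setOf_mem_NLP_oddPeaksIn hk, ← pathCount_eq hn hi]
  rfl

theorem pathProb_anti {n k k' i : ℕ} (hn : 0 < n) (hi : i ≤ (n - 1) / 2) (hkk : k ≤ k')
    (hk : k' ≤ n / 2) : pathProb n k' (n / 2 - i) ≤ pathProb n k (n / 2 - i) := by
  have hpos : ∀ l ≤ n / 2, 0 < (((stepOp ^ n) (Pi.single 0 1) (n - 2 * l) : ℕ) : ℚ) := by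
    intro l hl
    rw [← ncard_NLP hl]
    exact_mod_cast (Set.ncard_pos (finite_NLP n l)).2 (NLP_nonempty hl)
  rw [pathProb_eq hn hi hk, pathProb_eq hn hi (hkk.trans hk),
    div_le_div_iff₀ (hpos _ hk) (hpos _ (hkk.trans hk))]
  obtain ⟨r, hr⟩ : ∃ r, n = r + 1 + 2 * i := ⟨n - 1 - 2 * i, by omega⟩
  have h := quotientMono_pairOp_pow_stepOp_pow i r (n - 2 * k') (n - 2 * k) (by omega)
    (by omega) (by omega)
  rw [← hr, show r + 1 = n - 2 * i by omega] at h
  exact_mod_cast h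

/-! ### Standard Young tableaux with two rows as paths -/

theorem mem_twoRow_iff {n k : ℕ} {hk : k ≤ n / 2} {r c : ℕ} :
    (r, c) ∈ twoRow n k hk ↔ (r = 0 ∧ c < n - k) ∨ (r = 1 ∧ c < k) := by
  rw [twoRow, YoungDiagram.mem_ofRowLens]
  rcases r with _ | _ | r <;> simp

theorem cells_twoRow {n k : ℕ} (hk : k ≤ n / 2) :
    (twoRow n k hk).cells = {0} ×ˢ Finset.range (n - k) ∪ {1} ×ˢ Finset.range k := by
  ext ⟨r, c⟩
  rw [YoungDiagram.mem_cells, mem_twoRow_iff]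
  simp [and_comm, eq_comm]

theorem card_twoRow {n k : ℕ} (hk : k ≤ n / 2) : (twoRow n k hk).card = n := by
  rw [YoungDiagram.card, cells_twoRow, Finset.card_union_of_disjoint, Finset.card_product,
    Finset.card_product]
  · simp
    omega
  · rw [Finset.disjoint_left]
    simp

/-- The step of a path that corresponds to an entry in row `r`. -/
def rowStep (r : ℕ) : DyckStep := if r = 0 then DyckStep.U else DyckStep.D

namespace StandardYoungTableau

variable {n k : ℕ} {hk : k ≤ n / 2}

open Classical in
/-- The path whose `m`-th step is Up if and only if `m` is in the first row of `T`. -/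
noncomputable def toPath (T : StandardYoungTableau (twoRow n k hk)) : List DyckStep :=
  (List.range n).map fun m => if T.InRow 0 (m + 1) then DyckStep.U else DyckStep.D

theorem length_toPath (T : StandardYoungTableau (twoRow n k hk)) : T.toPath.length = n := by
  simp [toPath]

theorem InRow.mem_Icc {T : StandardYoungTableau (twoRow n k hk)} {r m : ℕ} (h : T.InRow r m) :
    m ∈ Set.Icc 1 n := by
  obtain ⟨c, hc, rfl⟩ := h
  have := T.bijOn'.mapsTo hc
  rwa [card_twoRow] at this

theorem inRow_one_iff {T : StandardYoungTableau (twoRow n k hk)} {m : ℕ} (hm : m ∈ Set.Icc 1 n) :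
    T.InRow 1 m ↔ ¬ T.InRow 0 m := by
  constructor
  · rintro ⟨c, hc, h⟩ ⟨c', hc', h'⟩
    have := T.bijOn'.injOn hc hc' (h.trans h'.symm)
    simp at this
  · intro h
    rw [← card_twoRow hk] at hm
    obtain ⟨⟨r, c⟩, hc, rfl⟩ := T.bijOn'.surjOn hm
    rcases mem_twoRow_iff.1 hc with ⟨rfl, -⟩ | ⟨rfl, -⟩
    · exact absurd ⟨c, hc, rfl⟩ h
    · exact ⟨c, hc, rfl⟩

theorem toPath_getElem?_eq_iff (T : StandardYoungTableau (twoRow n k hk)) {r : ℕ} (hr : r < 2)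
    (m : ℕ) : T.toPath[m]? = some (rowStep r) ↔ T.InRow r (m + 1) := by
  rcases Nat.lt_or_ge m n with hm | hm
  · have h1 := inRow_one_iff (T := T) (m := m + 1) ⟨by omega, by omega⟩
    simp only [toPath, List.getElem?_map, List.getElem?_range hm, Option.map_some, Option.some_inj]
    rcases (by omega : r = 0 ∨ r = 1) with rfl | rfl
    · simp [rowStep]
    · simp [rowStep, h1]
  · rw [List.getElem?_eq_none (by rwa [length_toPath])]
    constructor
    · simp
    · intro h
      have := h.mem_Icc.2
      omega

end StandardYoungTableau

theorem count_getElem?_eq (w : List DyckStep) (s : DyckStep) (x : ℕ) :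
    Nat.count (fun m => w[m]? = some s) x = (w.take x).count s := by
  induction x with
  | zero => simp
  | succ x ih =>
    rw [Nat.count_succ, ih, List.take_add_one, List.count_append]
    congr 1
    cases w[x]? <;> simp [List.count_singleton]

namespace StandardYoungTableau

variable {n k : ℕ} {hk : k ≤ n / 2}

theorem count_take_toPath (T : StandardYoungTableau (twoRow n k hk)) {r : ℕ} (hr : r < 2)
    (m : ℕ) : (T.toPath.take m).count (rowStep r) = T.rowCount r m := by
  rw [← count_getElem?_eq, Nat.count_eq_card_filter_range, rowCount]
  symm
  refine Finset.card_nbij (fun c => T.entry c.1 c.2 - 1) ?_ ?_ ?_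
  · rintro ⟨r', c⟩ h
    obtain ⟨hc, rfl, hm⟩ := Finset.mem_filter.1 h
    have hrow : T.InRow r' (T.entry r' c) := ⟨c, hc, rfl⟩
    have h1 := hrow.mem_Icc.1
    simp only at hm ⊢
    simp only [Finset.coe_filter, Finset.mem_range, Set.mem_ofPred_eq,
      toPath_getElem?_eq_iff T hr]
    rw [Nat.sub_add_cancel h1]
    exact ⟨by omega, hrow⟩
  · rintro ⟨r₁, c₁⟩ h₁ ⟨r₂, c₂⟩ h₂ h
    obtain ⟨h₁, -⟩ := Finset.mem_filter.1 h₁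
    obtain ⟨h₂, -⟩ := Finset.mem_filter.1 h₂
    have e₁ : 1 ≤ T.entry r₁ c₁ := (InRow.mem_Icc (T := T) ⟨c₁, h₁, rfl⟩).1
    have e₂ : 1 ≤ T.entry r₂ c₂ := (InRow.mem_Icc (T := T) ⟨c₂, h₂, rfl⟩).1
    refine T.bijOn'.injOn h₁ h₂ ?_
    simp only at h ⊢
    omega
  · intro x hx
    simp only [Finset.coe_filter, Finset.mem_range, Set.mem_ofPred_eq,
      toPath_getElem?_eq_iff T hr] at hx
    obtain ⟨hxm, c, hc, hxc⟩ := hx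
    exact ⟨(r, c), Finset.mem_filter.2 ⟨hc, rfl, by simp only; omega⟩, by simp only; omega⟩

theorem height_toPath (T : StandardYoungTableau (twoRow n k hk)) (m : ℕ) :
    height T.toPath m = T.rowDiff m := by
  rw [rowDiff, ← T.count_take_toPath two_pos, ← T.count_take_toPath one_lt_two]
  rfl

theorem isPeak_toPath_iff (T : StandardYoungTableau (twoRow n k hk)) (m : ℕ) :
    IsPeak T.toPath m ↔ T.IsDescent m := by
  have h0 := T.toPath_getElem?_eq_iff two_pos (m - 1)
  have h1 := T.toPath_getElem?_eq_iff one_lt_two m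
  constructor
  · rintro ⟨hm, hU, hD⟩
    rw [Nat.sub_add_cancel hm] at h0
    exact ⟨h0.1 hU, h1.1 hD⟩
  · rintro ⟨hU, hD⟩
    have hm := hU.mem_Icc.1
    rw [Nat.sub_add_cancel hm] at h0
    exact ⟨hm, h0.2 hU, h1.2 hD⟩

theorem oddPeaksIn_toPath_iff (T : StandardYoungTableau (twoRow n k hk)) (j : ℕ) :
    OddPeaksIn j T.toPath ↔ T.OddDescentsIn j := by
  simp only [OddPeaksIn, OddDescentsIn, isPeak_toPath_iff, height_toPath]

/-- Moving a second-row cell up its column gives a smaller entry; this is what keeps the path above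
the axis. -/
theorem rowCount_one_le (T : StandardYoungTableau (twoRow n k hk)) (m : ℕ) :
    T.rowCount 1 m ≤ T.rowCount 0 m := by
  refine Finset.card_le_card_of_injOn (fun c => (0, c.2)) ?_ ?_
  · rintro ⟨r, c⟩ h
    obtain ⟨hc, rfl, hm⟩ := Finset.mem_filter.1 h
    have : T.entry 0 c < T.entry 1 c := T.col_strict' one_pos hc
    have hc' := (twoRow n k hk).up_left_mem zero_le_one le_rfl hc
    simp only at hm
    exact Finset.mem_filter.2 ⟨hc', rfl, by simp only; omega⟩
  · rintro ⟨r₁, c₁⟩ h₁ ⟨r₂, c₂⟩ h₂ h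
    obtain ⟨-, rfl, -⟩ := Finset.mem_filter.1 h₁
    obtain ⟨-, rfl, -⟩ := Finset.mem_filter.1 h₂
    simpa using h

theorem toPath_mem_NLP (T : StandardYoungTableau (twoRow n k hk)) : T.toPath ∈ NLP n k := by
  refine ⟨T.length_toPath, ?_, fun x => ?_⟩
  · have h := T.count_take_toPath one_lt_two n
    rw [List.take_of_length_le T.length_toPath.le] at h
    change T.toPath.count (rowStep 1) = k
    have hcard : (({1} : Finset ℕ) ×ˢ Finset.range k).card = k := by simp
    rw [h, rowCount]
    refine Eq.trans ?_ hcard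
    congr 1
    ext ⟨r, c⟩
    simp only [Finset.mem_filter, YoungDiagram.mem_cells, mem_twoRow_iff, Finset.mem_product,
      Finset.mem_singleton, Finset.mem_range]
    constructor
    · rintro ⟨h, rfl, -⟩
      omega
    · rintro ⟨rfl, hc⟩
      have hrow : T.InRow 1 (T.entry 1 c) := ⟨c, mem_twoRow_iff.2 (Or.inr ⟨rfl, hc⟩), rfl⟩
      exact ⟨Or.inr ⟨rfl, hc⟩, rfl, hrow.mem_Icc.2⟩
  · rw [height_toPath, rowDiff, sub_nonneg]
    exact_mod_cast T.rowCount_one_le x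

theorem entry_lt_entry (T : StandardYoungTableau (twoRow n k hk)) {r c c' : ℕ} (h : c < c')
    (hc' : (r, c') ∈ twoRow n k hk) : T.entry r c < T.entry r c' := by
  refine lt_of_le_of_ne (T.row_weak' h hc') fun he => ?_
  have hc := (twoRow n k hk).up_left_mem le_rfl h.le hc'
  have := T.bijOn'.injOn hc hc' he
  simp only [Prod.mk.injEq, true_and] at this
  omega

/-- Rows increase, so the entries at most `m` fill an initial segment of the row. Hence the row
counts, which the path determines, recover every entry. -/
theorem lt_rowCount_iff (T : StandardYoungTableau (twoRow n k hk)) {r c : ℕ}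
    (hc : (r, c) ∈ twoRow n k hk) (m : ℕ) : c < T.rowCount r m ↔ T.entry r c ≤ m := by
  constructor
  · intro h
    by_contra! hm
    refine absurd h (not_lt.2 ?_)
    rw [show c = (({r} : Finset ℕ) ×ˢ Finset.range c).card by simp, rowCount]
    refine Finset.card_le_card ?_
    rintro ⟨r', c'⟩ h'
    obtain ⟨hc', rfl, hm'⟩ := Finset.mem_filter.1 h'
    simp only [Finset.mem_product, Finset.mem_singleton, Finset.mem_range, true_and]
    by_contra! hle
    simp only at hm'
    rcases eq_or_lt_of_le hle with rfl | hlt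
    · exact absurd hm' (not_le.2 hm)
    · exact absurd (hm'.trans_lt hm) (T.entry_lt_entry hlt hc').not_gt
  · intro h
    rw [← Nat.succ_le_iff, show c.succ = (({r} : Finset ℕ) ×ˢ Finset.range (c + 1)).card by simp,
      rowCount]
    refine Finset.card_le_card ?_
    rintro ⟨r', c'⟩ h'
    simp only [Finset.mem_product, Finset.mem_singleton, Finset.mem_range] at h'
    obtain ⟨rfl, h'⟩ := h'
    refine Finset.mem_filter.2 ⟨(twoRow n k hk).up_left_mem le_rfl (by omega) hc, rfl, ?_⟩
    rcases eq_or_lt_of_le (Nat.le_of_lt_succ h') with rfl | hlt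
    · exact h
    · exact (T.entry_lt_entry hlt hc).le.trans h

theorem toPath_injective :
    Function.Injective (toPath : StandardYoungTableau (twoRow n k hk) → List DyckStep) := by
  intro S T h
  have key : ∀ r c, (r, c) ∈ twoRow n k hk → ∀ m, S.entry r c ≤ m ↔ T.entry r c ≤ m := by
    intro r c hc m
    have hr : r < 2 := by
      have := mem_twoRow_iff.1 hc
      omega
    rw [← S.lt_rowCount_iff hc, ← T.lt_rowCount_iff hc, ← S.count_take_toPath hr,
      ← T.count_take_toPath hr, h]
  obtain ⟨S, hS⟩ := S
  obtain ⟨T, hT⟩ := T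
  obtain rfl : S = T := by
    ext r c
    by_cases hc : (r, c) ∈ twoRow n k hk
    · exact le_antisymm ((key r c hc _).2 le_rfl) ((key r c hc _).1 le_rfl)
    · rw [S.zeros hc, T.zeros hc]
  rfl

end StandardYoungTableau

/-! ### The tableau of a path: inverse of the bijection -/

section OfPath

variable {n k : ℕ} {w : List DyckStep}

theorem card_positions (s : DyckStep) (hf : {m : ℕ | w[m]? = some s}.Finite) :
    hf.toFinset.card = w.count s := by
  have hcount := count_getElem?_eq w s w.length
  rw [List.take_length, Nat.count_eq_card_filter_range] at hcount
  rw [← hcount]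
  congr 1
  ext m
  simp only [Set.Finite.mem_toFinset, Set.mem_ofPred_eq, Finset.mem_filter, Finset.mem_range]
  exact ⟨fun h => ⟨(List.getElem?_eq_some_iff.1 h).1, h⟩, fun h => h.2⟩

/-- The bound `hc` excludes the default value 0 that `Nat.nth` takes beyond the last occurrence. -/
theorem getElem?_nth {s : DyckStep} {c : ℕ} (hc : c < w.count s) :
    w[Nat.nth (fun m => w[m]? = some s) c]? = some s :=
  Nat.nth_mem c fun hf => by rwa [card_positions]

theorem exists_nth_eq {s : DyckStep} {m : ℕ} (h : w[m]? = some s) :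
    ∃ c < w.count s, Nat.nth (fun m => w[m]? = some s) c = m := by
  obtain ⟨c, hc, rfl⟩ := Nat.exists_lt_card_nth_eq (p := fun m => w[m]? = some s) h
  have hf : {m : ℕ | w[m]? = some s}.Finite :=
    (Set.finite_lt_nat w.length).subset fun m hm => (List.getElem?_eq_some_iff.1 hm).1
  exact ⟨c, card_positions s hf ▸ hc hf, rfl⟩

theorem nth_injOn_lt_count {s : DyckStep} {c c' : ℕ} (hc : c < w.count s) (hc' : c' < w.count s)
    (h : Nat.nth (fun m => w[m]? = some s) c = Nat.nth (fun m => w[m]? = some s) c') : c = c' := by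
  rcases lt_trichotomy c c' with hlt | heq | hlt
  · exact absurd h (Nat.nth_lt_nth' hlt fun hf => by rwa [card_positions]).ne
  · exact heq
  · exact absurd h (Nat.nth_lt_nth' hlt fun hf => by rwa [card_positions]).ne'

theorem exists_rowStep_eq (s : DyckStep) : ∃ r < 2, rowStep r = s := by
  cases s
  · exact ⟨0, two_pos, rfl⟩
  · exact ⟨1, one_lt_two, rfl⟩

theorem rowStep_injOn {r r' : ℕ} (hr : r < 2) (hr' : r' < 2) (h : rowStep r = rowStep r') :
    r = r' := by
  rcases (by omega : r = 0 ∨ r = 1) with rfl | rfl <;>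
    rcases (by omega : r' = 0 ∨ r' = 1) with rfl | rfl <;> simp [rowStep] at h ⊢

theorem mem_twoRow_iff_lt_count (hw : w ∈ NLP n k) {hk : k ≤ n / 2} {r c : ℕ} :
    (r, c) ∈ twoRow n k hk ↔ r < 2 ∧ c < w.count (rowStep r) := by
  have h := count_U_add_count_D w
  rw [hw.1, hw.2.1] at h
  rw [mem_twoRow_iff]
  constructor
  · rintro (⟨rfl, hc⟩ | ⟨rfl, hc⟩)
    · exact ⟨two_pos, by change c < w.count DyckStep.U; omega⟩
    · exact ⟨one_lt_two, by change c < w.count DyckStep.D; rwa [hw.2.1]⟩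
  · rintro ⟨hr, hc⟩
    rcases (by omega : r = 0 ∨ r = 1) with rfl | rfl
    · change c < w.count DyckStep.U at hc
      exact Or.inl ⟨rfl, by omega⟩
    · change c < w.count DyckStep.D at hc
      rw [hw.2.1] at hc
      exact Or.inr ⟨rfl, hc⟩

theorem nth_U_lt_nth_D (hw : w ∈ NLP n k) {c : ℕ} (hc : c < k) :
    Nat.nth (fun m => w[m]? = some DyckStep.U) c < Nat.nth (fun m => w[m]? = some DyckStep.D) c := by
  rw [← hw.2.1] at hc
  have hD := getElem?_nth hc
  have hcount := Nat.count_nth (p := fun m => w[m]? = some DyckStep.D) (n := c)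
    fun hf => by rwa [card_positions]
  refine Nat.nth_lt_of_lt_count ?_
  -- Just after the Down step of index `c` there have been `c + 1` Down steps, hence at least `c +
  -- 1` Up steps, all of them before that Down step.
  have h := hw.2.2 (Nat.nth (fun m => w[m]? = some DyckStep.D) c + 1)
  rw [height, ← count_getElem?_eq, ← count_getElem?_eq, Nat.count_succ, Nat.count_succ, hcount,
    hD] at h
  simp at h
  omega

open Classical in
/-- The entries of the tableau whose first row lists the positions of the Up steps of `w`, and whose
second row lists the positions of the Down steps. -/
noncomputable def pathEntry (hk : k ≤ n / 2) (w : List DyckStep) (r c : ℕ) : ℕ :=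
  if (r, c) ∈ twoRow n k hk then Nat.nth (fun m => w[m]? = some (rowStep r)) c + 1 else 0

theorem pathEntry_of_mem {hk : k ≤ n / 2} {r c : ℕ} (h : (r, c) ∈ twoRow n k hk) :
    pathEntry hk w r c = Nat.nth (fun m => w[m]? = some (rowStep r)) c + 1 :=
  if_pos h

theorem exists_pathEntry_eq_iff (hk : k ≤ n / 2) (hw : w ∈ NLP n k) {r : ℕ} (hr : r < 2) (m : ℕ) :
    (∃ c, (r, c) ∈ twoRow n k hk ∧ pathEntry hk w r c = m + 1) ↔ w[m]? = some (rowStep r) := by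
  constructor
  · rintro ⟨c, hc, h⟩
    rw [pathEntry_of_mem hc, Nat.add_right_cancel_iff] at h
    rw [← h]
    exact getElem?_nth ((mem_twoRow_iff_lt_count hw).1 hc).2
  · intro h
    obtain ⟨c, hc, hm⟩ := exists_nth_eq h
    have hc' : (r, c) ∈ twoRow n k hk := (mem_twoRow_iff_lt_count hw).2 ⟨hr, hc⟩
    exact ⟨c, hc', by rw [pathEntry_of_mem hc', hm]⟩

theorem bijOn_pathEntry (hk : k ≤ n / 2) (hw : w ∈ NLP n k) :
    Set.BijOn (fun c : ℕ × ℕ => pathEntry hk w c.1 c.2) ((twoRow n k hk).cells : Set (ℕ × ℕ))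
      (Set.Icc 1 (twoRow n k hk).card) := by
  rw [card_twoRow]
  refine ⟨?_, ?_, ?_⟩
  · rintro ⟨r, c⟩ h
    have h' : (r, c) ∈ twoRow n k hk := h
    have hm := getElem?_nth ((mem_twoRow_iff_lt_count hw).1 h').2
    have hlt := (List.getElem?_eq_some_iff.1 hm).1
    rw [hw.1] at hlt
    simp only [pathEntry_of_mem h']
    exact ⟨Nat.succ_pos _, hlt⟩
  · rintro ⟨r, c⟩ h ⟨r', c'⟩ h' heq
    have hc : (r, c) ∈ twoRow n k hk := h
    have hc' : (r', c') ∈ twoRow n k hk := h'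
    simp only [pathEntry_of_mem hc, pathEntry_of_mem hc', Nat.add_right_cancel_iff] at heq
    rw [mem_twoRow_iff_lt_count hw] at hc hc'
    have h1 := getElem?_nth hc.2
    rw [heq, getElem?_nth hc'.2, Option.some_inj] at h1
    obtain rfl := rowStep_injOn hc'.1 hc.1 h1
    rw [nth_injOn_lt_count hc.2 hc'.2 heq]
  · rintro m ⟨hm, hmn⟩
    obtain ⟨m, rfl⟩ := Nat.exists_eq_add_of_le' hm
    have hlt : m < w.length := by rw [hw.1]; omega
    obtain ⟨r, hr, hs⟩ := exists_rowStep_eq w[m]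
    obtain ⟨c, hc, h⟩ := (exists_pathEntry_eq_iff hk hw hr m).2
      (by rw [List.getElem?_eq_getElem hlt, hs])
    exact ⟨(r, c), hc, h⟩

/-- The tableau whose first row lists the positions of the Up steps of `w`, and whose second row
lists the positions of the Down steps. -/
noncomputable def ofPath (hk : k ≤ n / 2) (hw : w ∈ NLP n k) :
    StandardYoungTableau (twoRow n k hk) where
  entry := pathEntry hk w
  row_weak' := by
    intro r c c' h hc'
    rw [pathEntry_of_mem hc', pathEntry_of_mem ((twoRow n k hk).up_left_mem le_rfl h.le hc')]
    have := ((mem_twoRow_iff_lt_count hw).1 hc').2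
    exact Nat.succ_le_succ (Nat.nth_le_nth' h.le fun hf => by rwa [card_positions])
  col_strict' := by
    intro r r' c h hc'
    rw [pathEntry_of_mem hc', pathEntry_of_mem ((twoRow n k hk).up_left_mem h.le le_rfl hc')]
    obtain ⟨rfl, hc⟩ : r' = 1 ∧ c < k := by
      have := mem_twoRow_iff.1 hc'
      omega
    obtain rfl : r = 0 := by omega
    exact Nat.succ_lt_succ (nth_U_lt_nth_D hw hc)
  zeros' := fun h => if_neg h
  bijOn' := bijOn_pathEntry hk hw

theorem toPath_ofPath (hk : k ≤ n / 2) (hw : w ∈ NLP n k) : (ofPath hk hw).toPath = w := by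
  refine List.ext_getElem? fun m => ?_
  have h (r : ℕ) (hr : r < 2) :=
    ((ofPath hk hw).toPath_getElem?_eq_iff hr m).trans (exists_pathEntry_eq_iff hk hw hr m)
  have h0 := h 0 two_pos
  have h1 := h 1 one_lt_two
  have hlen := (ofPath hk hw).length_toPath.trans hw.1.symm
  rcases Nat.lt_or_ge m w.length with hm | hm
  · rw [List.getElem?_eq_getElem hm] at h0 h1 ⊢
    rcases hs : w[m] with _ | _
    · exact h0.2 (congrArg some hs)
    · exact h1.2 (congrArg some hs)
  · rw [List.getElem?_eq_none hm, List.getElem?_eq_none (hlen ▸ hm)]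

end OfPath

theorem sytProb_eq_pathProb {n k : ℕ} (hk : k ≤ n / 2) (j : ℕ) :
    sytProb n k hk j = pathProb n k j := by
  have himage (P : List DyckStep → Prop) :
      {T : StandardYoungTableau (twoRow n k hk) | P T.toPath}.ncard =
        {w ∈ NLP n k | P w}.ncard := by
    rw [← Set.ncard_image_of_injective _ StandardYoungTableau.toPath_injective]
    congr 1
    ext w
    constructor
    · rintro ⟨T, hT, rfl⟩
      exact ⟨T.toPath_mem_NLP, hT⟩
    · rintro ⟨hw, hP⟩
      exact ⟨ofPath hk hw, by rwa [Set.mem_ofPred_eq, toPath_ofPath], toPath_ofPath hk hw⟩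
  have h1 := himage (OddPeaksIn j)
  -- The trivial predicate compares the denominators.
  have h2 := himage fun _ => True
  simp only [StandardYoungTableau.oddPeaksIn_toPath_iff, and_true] at h1 h2
  rw [sytProb, pathProb, uniformProb, uniformProb]
  simp only [Set.mem_univ, true_and]
  rw [h1]
  congr 2

end TwoRowPeaks

theorem mainTheorem10 (n : ℕ) (hn : 0 < n) (i : ℕ) (hi : i ≤ (n - 1) / 2) :
    (∀ k k' : ℕ, k ≤ k' → k' ≤ n / 2 →
      TwoRowPeaks.pathProb n k' (n / 2 - i) ≤ TwoRowPeaks.pathProb n k (n / 2 - i)) ∧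
    (∀ (k k' : ℕ) (hk : k ≤ n / 2) (hk' : k' ≤ n / 2), k ≤ k' →
      TwoRowPeaks.sytProb n k' hk' (n / 2 - i) ≤ TwoRowPeaks.sytProb n k hk (n / 2 - i)) ∧
    (∀ (k : ℕ) (hk : k ≤ n / 2),
      TwoRowPeaks.sytProb n k hk (n / 2 - i) = TwoRowPeaks.pathProb n k (n / 2 - i)) := by
  refine ⟨fun k k' hkk hk' => TwoRowPeaks.pathProb_anti hn hi hkk hk', fun k k' hk hk' hkk => ?_,
    fun k hk => TwoRowPeaks.sytProb_eq_pathProb hk _⟩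
  rw [TwoRowPeaks.sytProb_eq_pathProb, TwoRowPeaks.sytProb_eq_pathProb]
  exact TwoRowPeaks.pathProb_anti hn hi hkk hk'
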